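/- **Setting.** Let $D_1,\dots,D_N$ be disks in the plane with pairwise disjoint interiors, centers $x^i$ and radii $a_i>0$. The contact graph $\Gamma$ joins $i$ and $j$ ($j\in\mathcal N_i$) iff $|x^i-x^j|=a_i+a_j$, and then $q^{ij}=(x^j-x^i)/|x^j-x^i|$. Its edge set is $\mathcal E=\{(i,j): j\in\mathcal N_i,\ i=1,\dots,N\}$, and $E=\#\mathcal E$; thus each contact appears as the two pairs $(i,j)$, $(j,i)$, and $E/N=\frac1N\sum_i\#\mathcal N_i$ is the mean coordination number. Assume that the edges of $\Gamma$ triangulate a bounded connected domain $\Omega$ with polygonal boundary, and that $\Gamma$ can be built from one triangle by successively adding triangles, each of which has a side among the edges already present. Vertices on $\partial\Omega$ are boundary vertices ($N_b$ of them), those in $\Omega$ are interior vertices. The boundary particles are divided into groups $1,\dots,M$, each boundary particle touches at least one other particle of its own group, and group $m$ moves by a prescribed infinitesimal rigid displacement: $$u^i=c^m+\alpha^mK(x^i-x^{\star,m})\quad\text{for every } i \text{ in group } m, \tag{1}$$ where $K$ is the clockwise rotation by $\pi/2$. The linearized impenetrability constraints are $$(u^j-u^i)\cdot q^{ij}\ge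 0,\qquad (i,j)\in\mathcal E. \tag{2}$$ Assume that some $(u^1,\dots,u^N)$ satisfies (1) and (2). An edge is active for such a $u$ if equality holds in (2). For $d>0$ and symmetric $\delta=(\delta_{ij})$ let $$Q(u)=\tfrac12 d^{-3}\sum_{i=1}^N\sum_{j\in\mathcal N_i}\big((u^j-u^i)\cdot q^{ij}-d\,\delta_{ij}\big)^2 .$$ **Order parameter.** The $k$-th neighborhood of $x^i$ consists of the vertices joined to $x^i$ by a path of $\Gamma$ with at most $k$ edges; $\rho(x^i,k)$ is the number of active edges with both ends in this neighborhood divided by the number of all edges with both ends in it. **Theorem.** There are $d^\star>0$ and $\delta$ with all $\delta_{ij}=\delta_{ji}\in(1/2,1)$ such that for every $d>d^\star$ the energy $Q$ has a unique minimizer subject to (1) and (2). At this minimizer every interior vertex $x^i$ has two active edges $(i,j_1),(i,j_2)$ with $q^{ij_1},q^{ij_2}$ linearly independent, and every vertex $x^i$ satisfies $$\rho(x^i,N)\ \ge\ \frac NE ,$$ where $N/E$ is the reciprocal of the mean coordination number. More precisely, $\rho(x^i,N)\ge (2N-N_b)/E$; and if each boundary particle touches at least two particles of its own group, then $\rho(x^i,N)\ge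 2N/E$. -/

import Mathlib

open scoped Classical

noncomputable section

namespace GranularNetwork

/-- The Euclidean plane. -/
abbrev Plane := EuclideanSpace ℝ (Fin 2)

/-- Clockwise rotation by `π / 2`. -/
def K (v : Plane) : Plane := !₂[v 1, -v 0]

/-- A packing of `N` disks in the plane with pairwise disjoint interiors. -/
structure DiskPacking (N : ℕ) where
  center : Fin N → Plane
  radius : Fin N → ℝ
  radius_pos : ∀ i, 0 < radius i
  impenetrable : ∀ i j, i ≠ j → radius i + radius j ≤ dist (center i) (center j)

namespace DiskPacking

variable {N : ℕ} (P : DiskPacking N)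

/-- The contact graph `Γ`: two vertices are joined iff the two disks touch. -/
def contactGraph : SimpleGraph (Fin N) where
  Adj i j := i ≠ j ∧ dist (P.center i) (P.center j) = P.radius i + P.radius j
  symm := ⟨fun _ _ h => ⟨h.1.symm, by rw [dist_comm, add_comm]; exact h.2⟩⟩
  loopless := ⟨fun _ h => h.1 rfl⟩

/-- The unit vector `q^{ij}` pointing from the center `x^i` to the center `x^j`. -/
def q (i j : Fin N) : Plane :=
  ‖P.center j - P.center i‖⁻¹ • (P.center j - P.center i)

/-- The edges of `Γ` cut the plane domain `Ω`, a bounded connected open set with polygonal boundary,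
into triangles. The triangulation is a geometric simplicial complex `T`; its vertices are the disk
centers, its edges are exactly the edges of `Γ`, each of its faces lies in a triangle, and its
triangles fill out the closure of `Ω` (so that `Ω` is the interior of a finite union of
triangles). -/
structure Triangulates (Ω : Set Plane) : Prop where
  isOpen : IsOpen Ω
  isConnected : IsConnected Ω
  isBounded : Bornology.IsBounded Ω
  regular : interior (closure Ω) = Ω
  exists_complex : ∃ T : Geometry.SimplicialComplex ℝ Plane,
    T.vertices = Set.range P.center ∧
    (∀ i j, P.contactGraph.Adj i j ↔
      i ≠ j ∧ ({P.center i, P.center j} : Finset Plane) ∈ T.faces) ∧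
    (∀ s ∈ T.faces, ∃ t ∈ T.faces, s ⊆ t ∧ t.card = 3) ∧
    T.space = closure Ω

end DiskPacking

/-- Sets of edges of the graph `G` that are obtained by starting with the three sides of one
triangle of `G` and adding triangles of `G` one after another, each new triangle `a b c` having a
side `a b` among the edges already present. (The third vertex `c` may be new, in which case two new
edges are added, or it may be present already.) -/
inductive BuiltFromTriangles {V : Type*} (G : SimpleGraph V) : Set (Sym2 V) → Prop
  | triangle (a b c : V) (hab : G.Adj a b) (hbc : G.Adj b c) (hac : G.Adj a c) :
      BuiltFromTriangles G {s(a, b), s(b, c), s(a, c)}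
  | add (S : Set (Sym2 V)) (a b c : V) (hS : BuiltFromTriangles G S) (hab : s(a, b) ∈ S)
      (hbc : G.Adj b c) (hac : G.Adj a c) :
      BuiltFromTriangles G (S ∪ {s(b, c), s(a, c)})

/-- Boundary data: the boundary particles are divided into `M` groups (`group i` is used only for
boundary particles `i`), and the group `m` moves by the infinitesimal rigid displacement
`x ↦ c m + α m • K (x - pivot m)`. -/
structure BoundaryMotion (N M : ℕ) where
  group : Fin N → Fin M
  c : Fin M → Plane
  α : Fin M → ℝ
  pivot : Fin M → Plane

/-- The infinitesimal rigid displacement `R^m` of the group `m`. -/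
def BoundaryMotion.rigid {N M : ℕ} (B : BoundaryMotion N M) (m : Fin M) (x : Plane) : Plane :=
  B.c m + B.α m • K (x - B.pivot m)

namespace DiskPacking

variable {N M : ℕ} (P : DiskPacking N) (Ω : Set Plane) (B : BoundaryMotion N M)

/-- A vertex is a boundary vertex if it lies on the boundary of `Ω`. -/
def IsBoundary (i : Fin N) : Prop := P.center i ∈ frontier Ω

/-- A vertex is an interior vertex if it lies in the (open) domain `Ω`. -/
def IsInterior (i : Fin N) : Prop := P.center i ∈ Ω

/-- The boundary neighbors of `i` that belong to the same group as `i`. -/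
def groupNeighbors (i : Fin N) : Set (Fin N) :=
  {j | P.IsBoundary Ω j ∧ B.group j = B.group i ∧ P.contactGraph.Adj i j}

/-- `t_{ij} = (u^j - u^i) · q^{ij}`. -/
def elongation (u : Fin N → Plane) (i j : Fin N) : ℝ :=
  inner ℝ (u j - u i) (P.q i j)

/-- The elastic energy `Q(u) = ½ d⁻³ ∑_i ∑_{j ∈ N_i} ((u^j - u^i) · q^{ij} - d δ_{ij})²`. -/
def energy (d : ℝ) (δ : Fin N → Fin N → ℝ) (u : Fin N → Plane) : ℝ :=
  1 / 2 * (d ^ 3)⁻¹ * ∑ i, ∑ j with P.contactGraph.Adj i j, (P.elongation u i j - d * δ i j) ^ 2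

/-- Displacements that satisfy the linearized impenetrability constraints and the boundary
conditions. -/
def feasible : Set (Fin N → Plane) :=
  {u | (∀ i j, P.contactGraph.Adj i j → 0 ≤ P.elongation u i j) ∧
    ∀ i, P.IsBoundary Ω i → u i = B.rigid (B.group i) (P.center i)}

/-- `u` minimizes the energy among the feasible displacements. -/
def IsMinimizer (d : ℝ) (δ : Fin N → Fin N → ℝ) (u : Fin N → Plane) : Prop :=
  u ∈ P.feasible Ω B ∧ IsMinOn (P.energy d δ) (P.feasible Ω B) u

/-- The edge `(i, j)` is active for the displacement `u`: its constraint holds as an equation. -/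
def IsActive (u : Fin N → Plane) (i j : Fin N) : Prop :=
  P.contactGraph.Adj i j ∧ P.elongation u i j = 0

/-- The edge set `{(i, j) : j ∈ N_i, i = 1, …, N}` of `Γ`; each contact appears as the two pairs
`(i, j)` and `(j, i)`. -/
def edges : Set (Fin N × Fin N) := {e | P.contactGraph.Adj e.1 e.2}

/-- The number `E` of elements of the edge set. -/
def edgeCount : ℕ := P.edges.ncard

/-- The coordination number of a particle, i.e. the number of its neighbors. -/
def coordination (i : Fin N) : ℕ := {j | P.contactGraph.Adj i j}.ncard

/-- The mean coordination number of the network. -/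
def meanCoordination : ℝ := (∑ i, (P.coordination i : ℝ)) / N

/-- The number of boundary vertices. -/
def boundaryCount : ℕ := {i | P.IsBoundary Ω i}.ncard

/-- The `k`-th neighborhood of the vertex `i`: the vertices that can be reached from `i` by a path
of `Γ` with at most `k` edges. -/
def neighborhood (i : Fin N) (k : ℕ) : Set (Fin N) :=
  {j | ∃ p : P.contactGraph.Walk i j, p.IsPath ∧ p.length ≤ k}

/-- The edges of the `k`-th neighborhood of `i`: those with both ends in it. -/
def neighborhoodEdges (i : Fin N) (k : ℕ) : Set (Fin N × Fin N) :=
  {e ∈ P.edges | e.1 ∈ P.neighborhood i k ∧ e.2 ∈ P.neighborhood i k}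

/-- The size-dependent order parameter `ρ(x^i, k)`: the number of active edges of the `k`-th
neighborhood of `i` divided by the number of all its edges. (Each contact contributes two pairs to
the numerator, if it is active, and two pairs to the denominator, so that the quotient is the
quotient of the numbers of contacts.) -/
def orderParameter (u : Fin N → Plane) (i : Fin N) (k : ℕ) : ℝ :=
  ({e ∈ P.neighborhoodEdges i k | P.IsActive u e.1 e.2}.ncard : ℝ) /
    ((P.neighborhoodEdges i k).ncard : ℝ)

end DiskPacking

end GranularNetwork

end

/-! The feasible set is a polytope, and the minimizer is one of its vertices, where enough
constraints are active.

Compactness comes from a positive self-stress. The three disks of a triangle touch at the points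
where the inscribed circle meets the sides. The incenters of two triangles with a common edge are
therefore joined by a segment orthogonal to that edge, and around an interior vertex these segments
form a closed polygon. Taking twice their lengths as `stress` gives equilibrium
(`sum_stress_smul_q`). By virtual work the stress-weighted sum of elongations is then the same for
all feasible displacements. Since all terms are nonnegative, every elongation is bounded. A network
built from triangles is infinitesimally rigid once two vertices are fixed, so the displacements are
bounded too (`isCompact_feasible`).

On the face of maximal total elongation choose an extreme point `u`. Its active edges determine all
displacements that vanish on the boundary (`eq_zero_of_mem_extremePoints`). Set `δ` to a constant,
lowered slightly on the active edges of `u`. For large `d` the linear part of the energy dominates: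
the constant favors maximal total elongation, and the lowered values single out `u`, with a gain
linear in the distance to `u` that absorbs the quadratic part (`exists_energy_lt`).

An interior vertex whose active edges were all parallel could be moved alone, orthogonally to them,
so it has two independent ones. A boundary particle has an active contact inside its rigid group.
Summing these counts over the vertices counts ordered active pairs, the same convention as for `E`.
-/

noncomputable section

namespace GranularNetwork

/-! ### Linear algebra in the plane -/

/-- The oriented area of the parallelogram spanned by two plane vectors. -/
def cross (a b : Plane) : ℝ := a 0 * b 1 - a 1 * b 0

lemma inner_plane (a b : Plane) : inner ℝ a b = a 0 * b 0 + a 1 * b 1 := by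
  simp [PiLp.inner_apply, Fin.sum_univ_two, mul_comm]

lemma norm_sq_plane (a : Plane) : ‖a‖ ^ 2 = a 0 ^ 2 + a 1 ^ 2 := by
  simp [EuclideanSpace.real_norm_sq_eq, Fin.sum_univ_two]

lemma plane_ext {a b : Plane} (h0 : a 0 = b 0) (h1 : a 1 = b 1) : a = b := by
  ext i; fin_cases i <;> assumption

@[simp] lemma K_zero_coord (v : Plane) : K v 0 = v 1 := by simp [K]

@[simp] lemma K_one_coord (v : Plane) : K v 1 = -v 0 := by simp [K]

lemma K_sub (a b : Plane) : K (a - b) = K a - K b :=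
  plane_ext (by simp) (by simp; ring)

lemma inner_K_self (a : Plane) : inner ℝ (K a) a = 0 := by
  rw [inner_plane]; simp; ring

/-- A vector orthogonal to two independent vectors vanishes. -/
lemma eq_zero_of_inner_eq_zero {a b w : Plane} (hab : cross a b ≠ 0) (ha : inner ℝ w a = 0)
    (hb : inner ℝ w b = 0) : w = 0 := by
  rw [inner_plane] at ha hb
  unfold cross at hab
  apply plane_ext
  · have : w 0 * (a 0 * b 1 - a 1 * b 0) = 0 := by linear_combination b 1 * ha - a 1 * hb
    simpa [hab] using this
  · have : w 1 * (a 0 * b 1 - a 1 * b 0) = 0 := by linear_combination a 0 * hb - b 0 * ha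
    simpa [hab] using this

lemma linearIndependent_of_cross_ne_zero {a b : Plane} (h : cross a b ≠ 0) :
    LinearIndependent ℝ ![a, b] := by
  rw [LinearIndependent.pair_iff]
  intro s t hst
  have h0 : s * a 0 + t * b 0 = 0 := by simpa using congrArg (fun v : Plane => v 0) hst
  have h1 : s * a 1 + t * b 1 = 0 := by simpa using congrArg (fun v : Plane => v 1) hst
  unfold cross at h
  constructor
  · have : s * (a 0 * b 1 - a 1 * b 0) = 0 := by linear_combination b 1 * h0 - b 0 * h1
    simpa [h] using this
  · have : t * (a 0 * b 1 - a 1 * b 0) = 0 := by linear_combination a 0 * h1 - a 1 * h0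
    simpa [h] using this

/-! ### Graphs built from triangles -/

lemma BuiltFromTriangles.subset_edgeSet {V : Type*} {G : SimpleGraph V} {S : Set (Sym2 V)}
    (hS : BuiltFromTriangles G S) : S ⊆ G.edgeSet := by
  induction hS with
  | triangle a b c hab hbc hac => rintro e (rfl | rfl | rfl) <;> assumption
  | add S a b c hS hab hbc hac ih =>
    rintro e (he | rfl | rfl)
    exacts [ih he, hbc, hac]

lemma BuiltFromTriangles.exists_reachable {V : Type*} {G : SimpleGraph V} {S : Set (Sym2 V)}
    (hS : BuiltFromTriangles G S) : ∃ r, ∀ e ∈ S, ∀ a ∈ e, G.Reachable r a := by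
  induction hS with
  | triangle a b c hab hbc hac =>
    have ha := SimpleGraph.Reachable.refl (G := G) a
    have hb := hab.reachable
    have hc := hac.reachable
    refine ⟨a, ?_⟩
    rintro e (rfl | rfl | rfl) x hx <;> rw [Sym2.mem_iff] at hx <;> rcases hx with rfl | rfl <;>
      assumption
  | add S a b c hS hab hbc hac ih =>
    obtain ⟨r, hr⟩ := ih
    have ha := hr _ hab a (by simp)
    have hb := hr _ hab b (by simp)
    have hc := ha.trans hac.reachable
    refine ⟨r, ?_⟩
    rintro e (he | rfl | rfl) x hx
    · exact hr e he x hx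
    all_goals
      rw [Sym2.mem_iff] at hx
      rcases hx with rfl | rfl <;> assumption

/-! ### Geometry of three touching disks; rigidity of triangles -/

namespace DiskPacking

variable {N : ℕ} (P : DiskPacking N)

lemma norm_sub_of_adj {i j : Fin N} (h : P.contactGraph.Adj i j) :
    ‖P.center j - P.center i‖ = P.radius i + P.radius j := by
  rw [norm_sub_rev, ← dist_eq_norm]; exact h.2

lemma norm_sub_pos_of_adj {i j : Fin N} (h : P.contactGraph.Adj i j) :
    0 < ‖P.center j - P.center i‖ := by
  rw [P.norm_sub_of_adj h]; exact add_pos (P.radius_pos i) (P.radius_pos j)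

lemma center_injective : Function.Injective P.center := by
  intro i j h
  by_contra hij
  have h1 := P.impenetrable i j hij
  rw [h, dist_self] at h1
  linarith [P.radius_pos i, P.radius_pos j]

lemma q_symm (i j : Fin N) : P.q j i = -P.q i j := by
  unfold q
  rw [norm_sub_rev, ← smul_neg, neg_sub]

lemma elongation_symm (u : Fin N → Plane) (i j : Fin N) :
    P.elongation u j i = P.elongation u i j := by
  unfold elongation
  rw [P.q_symm i j, inner_neg_right, ← inner_neg_left, neg_sub]

/-- Twice the oriented area of the triangle with the vertices `x^i`, `x^j`, `x^k`. -/
def orientedArea (i j k : Fin N) : ℝ :=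
  cross (P.center j - P.center i) (P.center k - P.center i)

lemma orientedArea_swap (i j k : Fin N) : P.orientedArea i k j = -P.orientedArea i j k := by
  unfold orientedArea cross; ring

lemma orientedArea_swap_left (i j k : Fin N) : P.orientedArea j i k = -P.orientedArea i j k := by
  unfold orientedArea cross; simp only [PiLp.sub_apply]; ring

section Triangle

variable {P} {i j k : Fin N} (hij : P.contactGraph.Adj i j) (hik : P.contactGraph.Adj i k)
  (hjk : P.contactGraph.Adj j k)

include hij hik hjk

/-- Law of cosines with sides equal to sums of radii, in the form needed for the tangent of half the
angle at `i`. -/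
lemma inner_sub_of_triangle :
    (P.radius i + P.radius j) * (P.radius i + P.radius k) +
      ((P.center j - P.center i) 0 * (P.center k - P.center i) 0 +
        (P.center j - P.center i) 1 * (P.center k - P.center i) 1) =
      2 * P.radius i * (P.radius i + P.radius j + P.radius k) := by
  have h1 := congrArg (· ^ 2) (P.norm_sub_of_adj hij)
  have h2 := congrArg (· ^ 2) (P.norm_sub_of_adj hik)
  have h3 := congrArg (· ^ 2) (P.norm_sub_of_adj hjk)
  simp only [norm_sq_plane, PiLp.sub_apply] at h1 h2 h3 ⊢
  linear_combination (1 / 2) * h1 + (1 / 2) * h2 - (1 / 2) * h3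

/-- Heron's formula: the semiperimeter is the sum of the radii, and its excess over each side is the
radius of the opposite disk. -/
lemma orientedArea_sq : P.orientedArea i j k ^ 2 =
    4 * (P.radius i + P.radius j + P.radius k) * P.radius i * P.radius j * P.radius k := by
  have h1 := congrArg (· ^ 2) (P.norm_sub_of_adj hij)
  have h2 := congrArg (· ^ 2) (P.norm_sub_of_adj hik)
  have h3 := inner_sub_of_triangle hij hik hjk
  simp only [norm_sq_plane] at h1 h2
  unfold orientedArea cross
  set X := P.center j - P.center i
  set Y := P.center k - P.center i
  have h4 : X 0 * Y 0 + X 1 * Y 1 = 2 * P.radius i * (P.radius i + P.radius j + P.radius k) -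
    (P.radius i + P.radius j) * (P.radius i + P.radius k) := by linarith
  have h5 : (X 0 * Y 1 - X 1 * Y 0) ^ 2 =
    (X 0 ^ 2 + X 1 ^ 2) * (Y 0 ^ 2 + Y 1 ^ 2) - (X 0 * Y 0 + X 1 * Y 1) ^ 2 := by ring
  rw [h5, h1, h2, h4]; ring

lemma orientedArea_ne_zero : P.orientedArea i j k ≠ 0 := by
  have h := orientedArea_sq hij hik hjk
  have hi := P.radius_pos i
  have hj := P.radius_pos j
  have hk := P.radius_pos k
  intro h0
  rw [h0] at h
  have : 0 < 4 * (P.radius i + P.radius j + P.radius k) * P.radius i * P.radius j * P.radius k := by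
    positivity
  linarith

lemma cross_q_ne_zero : cross (P.q i j) (P.q i k) ≠ 0 := by
  have h := orientedArea_ne_zero hij hik hjk
  have h1 := (P.norm_sub_pos_of_adj hij).ne'
  have h2 := (P.norm_sub_pos_of_adj hik).ne'
  have : cross (P.q i j) (P.q i k) = ‖P.center j - P.center i‖⁻¹ * ‖P.center k - P.center i‖⁻¹ *
      P.orientedArea i j k := by
    unfold q orientedArea cross
    simp only [PiLp.smul_apply, smul_eq_mul]; ring
  rw [this]
  exact mul_ne_zero (mul_ne_zero (inv_ne_zero h1) (inv_ne_zero h2)) h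

/-- The dual edges of a triangle, drawn from the center of its inscribed circle, are orthogonal to
the sides, and the two of them that belong to a vertex differ by the vector that joins the points
of contact. -/
lemma orientedArea_smul_q_add_q : P.orientedArea i j k • (P.q i j + P.q i k) =
    (2 * P.radius i * (P.radius i + P.radius j + P.radius k)) • K (P.q i k - P.q i j) := by
  have h1 := congrArg (· ^ 2) (P.norm_sub_of_adj hij)
  have h2 := congrArg (· ^ 2) (P.norm_sub_of_adj hik)
  have h3 := inner_sub_of_triangle hij hik hjk
  simp only [norm_sq_plane] at h1 h2
  have hl : P.radius i + P.radius j ≠ 0 := (add_pos (P.radius_pos i) (P.radius_pos j)).ne'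
  have hm : P.radius i + P.radius k ≠ 0 := (add_pos (P.radius_pos i) (P.radius_pos k)).ne'
  unfold orientedArea cross q
  rw [P.norm_sub_of_adj hij, P.norm_sub_of_adj hik, ← h3]
  generalize P.center j - P.center i = X at *
  generalize P.center k - P.center i = Y at *
  generalize P.radius i + P.radius j = l at *
  generalize P.radius i + P.radius k = m at *
  apply plane_ext
  · simp only [PiLp.add_apply, PiLp.smul_apply, smul_eq_mul, K_zero_coord, PiLp.sub_apply]
    field_simp
    linear_combination (m * Y 1) * h1 - (l * X 1) * h2
  · simp only [PiLp.add_apply, PiLp.smul_apply, smul_eq_mul, K_one_coord, PiLp.sub_apply]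
    field_simp
    linear_combination (-m * Y 0) * h1 + (l * X 0) * h2

end Triangle

/-- If the infinitesimal displacement keeps the lengths of all edges, then it is rigid on every set
of edges that is built from triangles. -/
lemma exists_rigid_of_built {v : Fin N → Plane}
    (hv : ∀ i j, P.contactGraph.Adj i j → P.elongation v i j = 0) {S : Set (Sym2 (Fin N))}
    (hS : BuiltFromTriangles P.contactGraph S) :
    ∃ (c : Plane) (α : ℝ), ∀ e ∈ S, ∀ a ∈ e, v a = c + α • K (P.center a) := by
  -- A rigid motion of two corners of a triangle extends to the third: the defect there is
  -- orthogonal to two independent sides.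
  have extend : ∀ (c : Plane) (α : ℝ) (i j k : Fin N), P.contactGraph.Adj i j →
      P.contactGraph.Adj j k → P.contactGraph.Adj i k → v i = c + α • K (P.center i) →
      v j = c + α • K (P.center j) → v k = c + α • K (P.center k) := by
    intro c α i j k hij hjk hik hi hj
    have key : ∀ l, P.contactGraph.Adj l k → v l = c + α • K (P.center l) →
        inner ℝ (v k - (c + α • K (P.center k))) (P.q k l) = 0 := by
      intro l hlk hl
      have h := hv l k hlk
      have e : v k - (c + α • K (P.center k)) =
          (v k - v l) + α • K (P.center l - P.center k) := by
        rw [hl, K_sub, smul_sub]; abel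
      rw [← P.elongation_symm] at h
      unfold elongation at h
      rw [e, inner_add_left, ← neg_sub (v l), inner_neg_left, h, neg_zero, zero_add]
      unfold q
      rw [inner_smul_left, inner_smul_right, inner_K_self]; simp
    exact sub_eq_zero.mp (eq_zero_of_inner_eq_zero (cross_q_ne_zero hik.symm hjk.symm hij)
      (key i hik hi) (key j hjk hj))
  induction hS with
  | triangle a b c hab hbc hac =>
    -- The relative displacement of `a` and `b` is orthogonal to their edge, hence an infinitesimal
    -- rotation.
    obtain ⟨α, hα⟩ : ∃ α : ℝ, v b - v a = α • K (P.center b - P.center a) := by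
      have h := hv a b hab
      have hn := P.norm_sub_pos_of_adj hab
      unfold elongation q at h
      rw [inner_smul_right, mul_eq_zero, or_iff_right (inv_ne_zero hn.ne')] at h
      have hs : ‖P.center b - P.center a‖ ^ 2 ≠ 0 := (pow_pos hn 2).ne'
      rw [norm_sq_plane] at hs
      rw [inner_plane] at h
      generalize v b - v a = W at *
      generalize P.center b - P.center a = X at *
      refine ⟨(W 0 * X 1 - W 1 * X 0) / (X 0 ^ 2 + X 1 ^ 2), plane_ext ?_ ?_⟩
      · simp only [PiLp.smul_apply, smul_eq_mul, K_zero_coord]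
        field_simp
        linear_combination X 0 * h
      · simp only [PiLp.smul_apply, smul_eq_mul, K_one_coord]
        field_simp
        linear_combination X 1 * h
    have ha : v a = (v a - α • K (P.center a)) + α • K (P.center a) := by abel
    have hb : v b = (v a - α • K (P.center a)) + α • K (P.center b) := by
      rw [K_sub, smul_sub] at hα
      rw [sub_eq_iff_eq_add.mp hα]; abel
    have hc := extend _ _ a b c hab hbc hac ha hb
    refine ⟨v a - α • K (P.center a), α, ?_⟩
    rintro e (rfl | rfl | rfl) x hx <;> rw [Sym2.mem_iff] at hx <;> rcases hx with rfl | rfl <;>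
      assumption
  | add S a b c hS hab hbc hac ih =>
    obtain ⟨d, α, hd⟩ := ih
    have ha := hd _ hab a (by simp)
    have hb := hd _ hab b (by simp)
    have hc := extend _ _ a b c (hS.subset_edgeSet hab) hbc hac ha hb
    refine ⟨d, α, ?_⟩
    rintro e (he | rfl | rfl) x hx
    · exact hd e he x hx
    all_goals
      rw [Sym2.mem_iff] at hx
      rcases hx with rfl | rfl <;> assumption

end DiskPacking

/-! ### Half-planes and overlapping triangles -/

lemma cross_smul_add_smul (a x y : Plane) (s t : ℝ) :
    cross a (s • x + t • y) = s * cross a x + t * cross a y := by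
  unfold cross; simp only [PiLp.add_apply, PiLp.smul_apply, smul_eq_mul]; ring

lemma cross_affine (e a x y : Plane) {s t : ℝ} (h : s + t = 1) :
    cross e (s • x + t • y - a) = s * cross e (x - a) + t * cross e (y - a) := by
  rw [← cross_smul_add_smul]
  congr 1
  rw [smul_sub, smul_sub, sub_add_sub_comm, ← add_smul, h, one_smul]

lemma convex_cross_nonpos (e a : Plane) : Convex ℝ {y | cross e (y - a) ≤ 0} := by
  intro x hx y hy s t hs ht hst
  simp only [Set.mem_ofPred_eq] at *
  rw [cross_affine e a x y hst]
  nlinarith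

lemma cross_self (e : Plane) : cross e e = 0 := by unfold cross; ring

lemma cross_zero (e : Plane) : cross e 0 = 0 := by simp [cross]

/-- Two triangles on the same side of a common edge overlap. -/
lemma exists_mem_inter_of_cross_pos {a b c c' : Plane} (hc : 0 < cross (b - a) (c - a))
    (hc' : 0 < cross (b - a) (c' - a)) :
    ∃ p ∈ convexHull ℝ ({a, b, c} : Set Plane) ∩ convexHull ℝ {a, b, c'},
      p ∉ convexHull ℝ ({a, b} : Set Plane) := by
  have comb : ∀ (z : Plane) (s t : ℝ), 0 ≤ s → 0 ≤ t → s + t ≤ 1 →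
      a + s • (b - a) + t • (z - a) ∈ convexHull ℝ ({a, b, z} : Set Plane) := by
    intro z s t hs ht hst
    have hconv := convex_convexHull ℝ ({a, b, z} : Set Plane)
    have ha := subset_convexHull ℝ ({a, b, z} : Set Plane) (by simp : a ∈ _)
    have hb := subset_convexHull ℝ ({a, b, z} : Set Plane) (by simp : b ∈ _)
    have hz := subset_convexHull ℝ ({a, b, z} : Set Plane) (by simp : z ∈ _)
    have h := hconv.sum_mem (t := Finset.univ) (w := ![1 - s - t, s, t]) (z := ![a, b, z])
      (by intro i _; fin_cases i <;> simp <;> linarith)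
      (by simp [Fin.sum_univ_three]; ring)
      (by intro i _; fin_cases i <;> simpa)
    convert h using 1
    simp only [Fin.sum_univ_three, Matrix.cons_val]
    module
  -- Coordinates of `c'` by Cramer's rule; `β` is positive because `c` and `c'` lie on the same
  -- side.
  obtain ⟨α, β, hβ, h⟩ : ∃ α β : ℝ, 0 < β ∧ c' - a = α • (b - a) + β • (c - a) := by
    refine ⟨cross (c' - a) (c - a) / cross (b - a) (c - a),
      cross (b - a) (c' - a) / cross (b - a) (c - a), div_pos hc' hc, ?_⟩
    have h0 := hc.ne'
    generalize b - a = X at *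
    generalize c - a = Y at *
    generalize c' - a = Z at *
    unfold cross at *
    apply plane_ext <;> simp only [PiLp.add_apply, PiLp.smul_apply, smul_eq_mul] <;>
      rw [div_mul_eq_mul_div, div_mul_eq_mul_div, ← add_div, eq_div_iff h0] <;> ring
  have hD : 0 < 2 * (1 + |α| + β) := by positivity
  -- The common point is the midpoint of the edge pushed by `η` towards `c'`. This `η` is small
  -- enough for its barycentric coordinates in both triangles to be nonnegative.
  set η : ℝ := 1 / (2 * (1 + |α| + β)) with hη
  have hη0 : 0 < η := by positivity
  have hη1 : η * (1 + |α| + β) = 1 / 2 := by rw [hη]; field_simp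
  have h1 : η * α ≤ η * |α| := mul_le_mul_of_nonneg_left (le_abs_self α) hη0.le
  have h2 : -(η * |α|) ≤ η * α := by
    rw [← mul_neg]; exact mul_le_mul_of_nonneg_left (neg_abs_le α) hη0.le
  have h3 : 0 ≤ η * |α| := by positivity
  have h4 : 0 < η * β := by positivity
  refine ⟨a + (1 / 2 : ℝ) • (b - a) + η • (c' - a), ⟨?_, ?_⟩, ?_⟩
  · have e : a + (1 / 2 : ℝ) • (b - a) + η • (c' - a) =
        a + (1 / 2 + η * α) • (b - a) + (η * β) • (c - a) := by rw [h]; module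
    rw [e]
    exact comb c _ _ (by linarith) h4.le (by linarith)
  · exact comb c' _ _ (by norm_num) hη0.le (by linarith)
  · intro hp
    have hsub : convexHull ℝ ({a, b} : Set Plane) ⊆ {y | cross (b - a) (y - a) ≤ 0} := by
      apply convexHull_min _ (convex_cross_nonpos _ _)
      rintro x (rfl | rfl)
      · simp [cross_zero]
      · simp [cross_self]
    have h5 := hsub hp
    have e : a + (1 / 2 : ℝ) • (b - a) + η • (c' - a) - a =
      (1 / 2 : ℝ) • (b - a) + η • (c' - a) := by abel
    rw [Set.mem_ofPred_eq, e, cross_smul_add_smul, cross_self] at h5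
    have := mul_pos hη0 hc'
    linarith

/-! ### The triangles at an edge of the complex -/

namespace DiskPacking

variable {N : ℕ} (P : DiskPacking N)

/-- The simplicial complex `T` realizes the contact graph as a triangulation of `Ω`. -/
structure IsTriangulation (Ω : Set Plane) (T : Geometry.SimplicialComplex ℝ Plane) : Prop where
  vertices_eq : T.vertices = Set.range P.center
  adj_iff : ∀ i j, P.contactGraph.Adj i j ↔
      i ≠ j ∧ ({P.center i, P.center j} : Finset Plane) ∈ T.faces
  exists_triangle : ∀ s ∈ T.faces, ∃ t ∈ T.faces, s ⊆ t ∧ t.card = 3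
  space_eq : T.space = closure Ω

/-- The vertices `i`, `j`, `k` are the three corners of a triangle of `T`. -/
def IsTriangle (T : Geometry.SimplicialComplex ℝ Plane) (i j k : Fin N) : Prop :=
  i ≠ j ∧ i ≠ k ∧ j ≠ k ∧ ({P.center i, P.center j, P.center k} : Finset Plane) ∈ T.faces

variable {P} {T : Geometry.SimplicialComplex ℝ Plane} {i j k : Fin N}

lemma IsTriangle.swap (h : P.IsTriangle T i j k) : P.IsTriangle T i k j :=
  ⟨h.2.1, h.1, h.2.2.1.symm, by rw [Finset.pair_comm]; exact h.2.2.2⟩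

lemma IsTriangle.swap_left (h : P.IsTriangle T i j k) : P.IsTriangle T j i k :=
  ⟨h.1.symm, h.2.2.1, h.2.1, by rw [Finset.insert_comm]; exact h.2.2.2⟩

lemma isTriangle_swap_left : P.IsTriangle T i j k ↔ P.IsTriangle T j i k :=
  ⟨.swap_left, .swap_left⟩

/-- Two different triangles would meet only in the common edge, but triangles on the same side of it
overlap beyond it. -/
lemma IsTriangle.eq_of_orientedArea_pos {k' : Fin N} (h : P.IsTriangle T i j k)
    (h' : P.IsTriangle T i j k') (hpos : 0 < P.orientedArea i j k) (hpos' : 0 < P.orientedArea i j k') : k = k' := by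
  by_contra hk
  obtain ⟨p, ⟨hp, hp'⟩, hn⟩ := exists_mem_inter_of_cross_pos hpos hpos'
  apply hn
  have := T.inter_subset_convexHull h.2.2.2 h'.2.2.2
    (a := p) ⟨by simpa using hp, by simpa using hp'⟩
  refine convexHull_mono ?_ this
  rintro x ⟨hx, hx'⟩
  simp only [Finset.coe_insert, Finset.coe_singleton, Set.mem_insert_iff,
    Set.mem_singleton_iff] at hx hx' ⊢
  rcases hx with hx | hx | hx
  · exact Or.inl hx
  · exact Or.inr hx
  · rcases hx' with hx' | hx' | hx'
    · exact Or.inl hx'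
    · exact Or.inr hx'
    · exact absurd (P.center_injective (hx.symm.trans hx')) hk

namespace IsTriangulation

variable {Ω : Set Plane} (hT : P.IsTriangulation Ω T)

include hT

lemma mem_range_of_mem_face {s : Finset Plane} (hs : s ∈ T.faces) {x : Plane} (hx : x ∈ s) :
    x ∈ Set.range P.center := by
  rw [← hT.vertices_eq]
  exact T.down_closed hs (by simpa using hx) (by simp)

lemma finite_faces : T.faces.Finite := by
  apply ((Set.finite_range P.center).toFinset.powerset.finite_toSet).subset
  intro s hs
  rw [Finset.mem_coe, Finset.mem_powerset]
  intro x hx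
  simpa using hT.mem_range_of_mem_face hs hx

lemma adj_of_isTriangle (h : P.IsTriangle T i j k) : P.contactGraph.Adj i j := by
  rw [hT.adj_iff]
  refine ⟨h.1, T.down_closed h.2.2.2 ?_ (by simp)⟩
  intro x hx
  simp only [Finset.mem_insert, Finset.mem_singleton] at hx ⊢
  tauto

lemma exists_isTriangle_of_mem {t : Finset Plane} (ht : t ∈ T.faces) (hcard : t.card = 3)
    (hij : i ≠ j) (hi : P.center i ∈ t) (hj : P.center j ∈ t) :
    ∃ k, P.IsTriangle T i j k ∧ t = {P.center i, P.center j, P.center k} := by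
  have hij' : P.center j ≠ P.center i := fun h => hij (P.center_injective h.symm)
  have hj' : P.center j ∈ t.erase (P.center i) := Finset.mem_erase.mpr ⟨hij', hj⟩
  have h1 : ((t.erase (P.center i)).erase (P.center j)).card = 1 := by
    rw [Finset.card_erase_of_mem hj', Finset.card_erase_of_mem hi, hcard]
  obtain ⟨z, hz⟩ := Finset.card_eq_one.mp h1
  have hzm : z ∈ (t.erase (P.center i)).erase (P.center j) := by rw [hz]; simp
  rw [Finset.mem_erase, Finset.mem_erase] at hzm
  obtain ⟨k, rfl⟩ := hT.mem_range_of_mem_face ht hzm.2.2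
  have e : t = {P.center i, P.center j, P.center k} := by
    rw [← hz, Finset.insert_erase hj', Finset.insert_erase hi]
  exact ⟨k, ⟨hij, fun h => hzm.2.1 (by rw [h]), fun h => hzm.1 (by rw [h]), e ▸ ht⟩, e⟩

lemma exists_isTriangle (h : P.contactGraph.Adj i j) : ∃ k, P.IsTriangle T i j k := by
  obtain ⟨t, ht, hsub, hcard⟩ := hT.exists_triangle _ ((hT.adj_iff i j).mp h).2
  obtain ⟨k, hk, -⟩ := hT.exists_isTriangle_of_mem ht hcard h.1 (hsub (by simp)) (hsub (by simp))
  exact ⟨k, hk⟩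

lemma exists_adj (i : Fin N) : ∃ j, P.contactGraph.Adj i j := by
  have hi : P.center i ∈ T.vertices := by rw [hT.vertices_eq]; exact ⟨i, rfl⟩
  obtain ⟨t, ht, hsub, hcard⟩ := hT.exists_triangle _ hi
  obtain ⟨x, hx, hxi⟩ := Finset.exists_mem_ne (s := t) (by omega) (P.center i)
  obtain ⟨j, rfl⟩ := hT.mem_range_of_mem_face ht hx
  have hij : i ≠ j := fun h => hxi (by rw [h])
  obtain ⟨k, hk, -⟩ := hT.exists_isTriangle_of_mem ht hcard hij (hsub (by simp)) hx
  exact ⟨j, hT.adj_of_isTriangle hk⟩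

/-- Points just to the left of `m` still lie in `Ω`, so one of the finitely many triangles contains
such points arbitrarily close to `m`. Being closed, it contains `m`. Since `m` is inside the edge,
both ends are corners of that triangle. -/
lemma exists_isTriangle_pos (hΩ : IsOpen Ω) (h : P.contactGraph.Adj i j) {m : Plane}
    (hm : m ∈ openSegment ℝ (P.center i) (P.center j)) (hmΩ : m ∈ Ω) :
    ∃ k, P.IsTriangle T i j k ∧ 0 < P.orientedArea i j k := by
  have hne : P.center i ≠ P.center j := fun e => h.1 (P.center_injective e)
  set e := P.center j - P.center i with he
  have he0 : 0 < ‖e‖ := P.norm_sub_pos_of_adj h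
  -- `K` turns clockwise, so subtracting `K e` moves to the side of positive orientation.
  let p : ℝ → Plane := fun η => m - η • K e
  have hp : Filter.Tendsto p (nhdsWithin 0 (Set.Ioi 0)) (nhds m) := by
    have hc : Continuous p := by fun_prop
    have := hc.tendsto 0
    simp only [p, zero_smul, sub_zero] at this
    exact this.mono_left nhdsWithin_le_nhds
  obtain ⟨t, ⟨ht, hcard⟩, hfreq⟩ : ∃ t ∈ {t | t ∈ T.faces ∧ t.card = 3},
      ∃ᶠ η in nhdsWithin (0 : ℝ) (Set.Ioi 0), p η ∈ convexHull ℝ (t : Set Plane) := by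
    by_contra! hcon
    have hfin : {t | t ∈ T.faces ∧ t.card = 3}.Finite := hT.finite_faces.subset fun t ht => ht.1
    have hall := (Filter.eventually_all_finite hfin).mpr fun t ht =>
      hcon t ht
    obtain ⟨η, hη, hηΩ⟩ := (hall.and (hp.eventually (hΩ.mem_nhds hmΩ))).exists
    have hs : p η ∈ T.space := by rw [hT.space_eq]; exact subset_closure hηΩ
    obtain ⟨s, hs, hps⟩ := T.mem_space_iff.mp hs
    obtain ⟨t, ht, hst, hcard⟩ := hT.exists_triangle s hs
    exact hη t ⟨ht, hcard⟩ (convexHull_mono (by exact_mod_cast hst) hps)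
  have hmt : m ∈ convexHull ℝ (t : Set Plane) :=
    (t.finite_toSet.isClosed_convexHull ℝ).mem_of_frequently_of_tendsto hfreq hp
  have hmem := T.inter_subset_convexHull ((hT.adj_iff i j).mp h).2 ht (a := m)
    ⟨by
      rw [Finset.coe_pair, convexHull_pair]
      exact openSegment_subset_segment ℝ _ _ hm, hmt⟩
  rw [Finset.coe_pair] at hmem
  have hi : P.center i ∈ t := by
    by_contra hi
    have hsub : ({P.center i, P.center j} ∩ (t : Set Plane)) ⊆ {P.center j} := by
      rintro x ⟨rfl | hx, hxt⟩
      exacts [absurd hxt hi, hx]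
    have := convexHull_mono hsub hmem
    rw [convexHull_singleton, Set.mem_singleton_iff] at this
    rw [this, right_mem_openSegment_iff] at hm
    exact hne hm
  have hj : P.center j ∈ t := by
    by_contra hj
    have hsub : ({P.center i, P.center j} ∩ (t : Set Plane)) ⊆ {P.center i} := by
      rintro x ⟨hx | rfl, hxt⟩
      exacts [hx, absurd hxt hj]
    have := convexHull_mono hsub hmem
    rw [convexHull_singleton, Set.mem_singleton_iff] at this
    rw [this, left_mem_openSegment_iff] at hm
    exact hne hm
  obtain ⟨k, hk, rfl⟩ := hT.exists_isTriangle_of_mem ht hcard h.1 hi hj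
  refine ⟨k, hk, ?_⟩
  by_contra! hneg
  have hsub : convexHull ℝ (({P.center i, P.center j, P.center k} : Finset Plane) : Set Plane) ⊆
      {y | cross e (y - P.center i) ≤ 0} := by
    apply convexHull_min _ (convex_cross_nonpos _ _)
    simp only [Finset.coe_insert, Finset.coe_singleton]
    rintro x (rfl | rfl | rfl)
    · simp [cross_zero]
    · simp [← he, cross_self]
    · exact hneg
  obtain ⟨η, hη, hη0⟩ := (hfreq.and_eventually self_mem_nhdsWithin).exists
  have h1 := hsub hη
  obtain ⟨s, r, -, -, hsr, rfl⟩ := hm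
  have e1 : p η - P.center i = r • e + (-η) • K e := by
    simp only [p, he]
    rw [← eq_sub_iff_add_eq] at hsr
    rw [hsr]; module
  rw [Set.mem_ofPred_eq, e1, cross_smul_add_smul, cross_self] at h1
  have h2 : cross e (K e) = -‖e‖ ^ 2 := by
    rw [norm_sq_plane]; simp [cross]; ring
  rw [h2] at h1
  have h3 : 0 < η * ‖e‖ ^ 2 := mul_pos hη0 (pow_pos he0 2)
  linarith

end IsTriangulation

end DiskPacking

/-! ### The positive self-stress and the rigidity of the pinned network -/

namespace DiskPacking

variable {N M : ℕ} (P : DiskPacking N)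

/-- The length of the dual edge that joins the centers of the inscribed circles of the triangles
containing the edge `i j` (a boundary edge has only one such triangle). -/
def stress (T : Geometry.SimplicialComplex ℝ Plane) (i j : Fin N) : ℝ :=
  ∑ k with P.IsTriangle T i j k,
    |P.orientedArea i j k| / (P.radius i + P.radius j + P.radius k)

variable {P} {T : Geometry.SimplicialComplex ℝ Plane} {Ω : Set Plane}

lemma stress_symm (i j : Fin N) : P.stress T j i = P.stress T i j := by
  unfold stress
  refine Finset.sum_congr (by ext k; simp [isTriangle_swap_left]) fun k _ => ?_
  rw [orientedArea_swap_left, abs_neg, add_comm (P.radius j)]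

namespace IsTriangulation

variable (hT : P.IsTriangulation Ω T)

include hT

lemma orientedArea_ne_zero {i j k : Fin N} (h : P.IsTriangle T i j k) :
    P.orientedArea i j k ≠ 0 :=
  DiskPacking.orientedArea_ne_zero (hT.adj_of_isTriangle h) (hT.adj_of_isTriangle h.swap)
    (hT.adj_of_isTriangle h.swap_left.swap)

lemma stress_pos {i j : Fin N} (h : P.contactGraph.Adj i j) : 0 < P.stress T i j := by
  obtain ⟨k, hk⟩ := hT.exists_isTriangle h
  refine Finset.sum_pos (fun l hl => div_pos ?_ ?_) ⟨k, by simpa using hk⟩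
  · exact abs_pos.mpr (hT.orientedArea_ne_zero (by simpa using hl))
  · exact add_pos (add_pos (P.radius_pos i) (P.radius_pos j)) (P.radius_pos l)

lemma stress_eq_zero {i j : Fin N} (h : ¬P.contactGraph.Adj i j) : P.stress T i j = 0 := by
  refine Finset.sum_eq_zero fun k hk => ?_
  exact absurd (hT.adj_of_isTriangle (by simpa using hk)) h

/-- An edge at an interior vertex has exactly one triangle on each side. -/
lemma sum_sign_orientedArea (hΩ : IsOpen Ω) {i : Fin N} (hi : P.IsInterior Ω i) (j : Fin N) :
    ∑ k with P.IsTriangle T i j k, (SignType.sign (P.orientedArea i j k) : ℝ) = 0 := by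
  by_cases h : P.contactGraph.Adj i j
  swap
  · refine Finset.sum_eq_zero fun k hk => ?_
    exact absurd (hT.adj_of_isTriangle (by simpa using hk)) h
  -- Only one end of the edge need be interior: points of the edge close to it lie in the open set
  -- `Ω`.
  obtain ⟨m, hm, hmΩ⟩ : ∃ m ∈ openSegment ℝ (P.center i) (P.center j), m ∈ Ω := by
    have hc : Continuous fun s : ℝ => P.center i + s • (P.center j - P.center i) := by fun_prop
    have ht := hc.tendsto 0
    simp only [zero_smul, add_zero] at ht
    have h1 := (ht.mono_left (nhdsWithin_le_nhds (s := Set.Ioi 0))).eventually (hΩ.mem_nhds hi)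
    have h2 : ∀ᶠ s : ℝ in nhdsWithin 0 (Set.Ioi 0), s ∈ Set.Ioo (0 : ℝ) 1 :=
      Ioo_mem_nhdsGT one_pos
    obtain ⟨s, hs, hs01⟩ := (h1.and h2).exists
    refine ⟨_, ?_, hs⟩
    rw [openSegment_eq_image']
    exact ⟨s, hs01, rfl⟩
  obtain ⟨k, hk, hkpos⟩ := hT.exists_isTriangle_pos hΩ h hm hmΩ
  obtain ⟨l, hl, hlpos⟩ := hT.exists_isTriangle_pos hΩ h.symm (by rwa [openSegment_symm]) hmΩ
  have hlneg : P.orientedArea i j l < 0 := by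
    rw [orientedArea_swap_left] at hlpos; linarith
  have hkl : k ≠ l := fun e => by rw [e] at hkpos; linarith
  have e : Finset.univ.filter (fun k => P.IsTriangle T i j k) = {k, l} := by
    ext r
    simp only [Finset.mem_filter, Finset.mem_univ, true_and, Finset.mem_insert,
      Finset.mem_singleton]
    constructor
    · intro hr
      rcases (hT.orientedArea_ne_zero hr).lt_or_gt with h0 | h0
      · right
        refine hr.swap_left.eq_of_orientedArea_pos hl ?_ hlpos
        rw [orientedArea_swap_left]; linarith
      · exact Or.inl (hr.eq_of_orientedArea_pos hk h0 hkpos)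
    · rintro (rfl | rfl)
      exacts [hk, hl.swap_left]
  rw [e, Finset.sum_pair hkl, sign_pos hkpos, sign_neg hlneg]
  simp

/-- The stresses are in equilibrium at the interior vertices. -/
lemma sum_stress_smul_q (hΩ : IsOpen Ω) {i : Fin N} (hi : P.IsInterior Ω i) :
    ∑ j, P.stress T i j • P.q i j = 0 := by
  -- `f` splits the force by triangles. After symmetrizing in `j` and `k`, the incenter identity
  -- turns `f` into `-g`; and `g` sums to zero over `k`, because the triangles on the two sides of
  -- the edge `i j` have opposite signs.
  let f : Fin N → Fin N → Plane := fun j k => if P.IsTriangle T i j k then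
    (|P.orientedArea i j k| / (P.radius i + P.radius j + P.radius k)) • P.q i j else 0
  let g : Fin N → Fin N → Plane := fun j k => if P.IsTriangle T i j k then
    (2 * P.radius i * SignType.sign (P.orientedArea i j k)) • K (P.q i j) else 0
  have hf : ∑ j, P.stress T i j • P.q i j = ∑ j, ∑ k, f j k := by
    refine Finset.sum_congr rfl fun j _ => ?_
    rw [stress, Finset.sum_smul, Finset.sum_filter]
  have hg : ∑ j, ∑ k, g j k = 0 := by
    refine Finset.sum_eq_zero fun j _ => ?_
    rw [← Finset.sum_filter, ← Finset.sum_smul, ← Finset.mul_sum,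
      hT.sum_sign_orientedArea hΩ hi, mul_zero, zero_smul]
  have hfg : ∀ j k, f j k + f k j = -(g j k + g k j) := by
    intro j k
    by_cases h : P.IsTriangle T i j k
    swap
    · have h' : ¬P.IsTriangle T i k j := fun h' => h h'.swap
      simp [f, g, h, h']
    have key := orientedArea_smul_q_add_q (hT.adj_of_isTriangle h) (hT.adj_of_isTriangle h.swap)
      (hT.adj_of_isTriangle h.swap_left.swap)
    have hs : P.radius i + P.radius j + P.radius k ≠ 0 :=
      (add_pos (add_pos (P.radius_pos i) (P.radius_pos j)) (P.radius_pos k)).ne'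
    simp only [f, g, if_pos h, if_pos h.swap]
    rw [P.orientedArea_swap i j k, abs_neg, Left.sign_neg, add_right_comm (P.radius i) (P.radius k),
      ← smul_add]
    have e : |P.orientedArea i j k| / (P.radius i + P.radius j + P.radius k) =
        (SignType.sign (P.orientedArea i j k) / (P.radius i + P.radius j + P.radius k)) *
          P.orientedArea i j k := by
      rw [div_mul_eq_mul_div, sign_mul_self]
    rw [e, mul_smul, key, smul_smul, K_sub]
    have e' : (SignType.sign (P.orientedArea i j k) : ℝ) /
        (P.radius i + P.radius j + P.radius k) *
          (2 * P.radius i * (P.radius i + P.radius j + P.radius k)) =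
        2 * P.radius i * SignType.sign (P.orientedArea i j k) := by
      field_simp
    rw [e', SignType.coe_neg]
    module
  have h2 : (2 : ℝ) • ∑ j, ∑ k, f j k = 0 :=
    calc (2 : ℝ) • ∑ j, ∑ k, f j k = (∑ j, ∑ k, f j k) + ∑ j, ∑ k, f k j := by
          rw [two_smul, Finset.sum_comm (f := fun j k => f k j)]
      _ = -((∑ j, ∑ k, g j k) + ∑ j, ∑ k, g k j) := by
          simp_rw [← Finset.sum_add_distrib, hfg, Finset.sum_neg_distrib]
      _ = 0 := by rw [Finset.sum_comm (f := fun j k => g k j), hg, add_zero, neg_zero]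
  rw [hf]
  exact (smul_eq_zero.mp h2).resolve_left two_ne_zero

/-- The principle of virtual work. -/
lemma sum_stress_mul_elongation (hΩ : IsOpen Ω) {v : Fin N → Plane}
    (hv : ∀ i, ¬P.IsInterior Ω i → v i = 0) :
    ∑ i, ∑ j, P.stress T i j * P.elongation v i j = 0 := by
  have h0 : ∑ i, ∑ j, P.stress T i j * inner ℝ (v i) (P.q i j) = 0 := by
    refine Finset.sum_eq_zero fun i _ => ?_
    by_cases hi : P.IsInterior Ω i
    · have h := congrArg (inner ℝ (v i)) (hT.sum_stress_smul_q hΩ hi)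
      simpa only [inner_sum, inner_smul_right, inner_zero_right] using h
    · simp [hv i hi]
  have h1 : ∑ i, ∑ j, P.stress T i j * inner ℝ (v j) (P.q i j) = 0 := by
    rw [Finset.sum_comm, ← neg_eq_zero, ← h0]
    simp_rw [← Finset.sum_neg_distrib]
    refine Finset.sum_congr rfl fun i _ => Finset.sum_congr rfl fun j _ => ?_
    rw [stress_symm, P.q_symm, inner_neg_right]; ring
  unfold elongation
  simp_rw [inner_sub_left, mul_sub, Finset.sum_sub_distrib]
  rw [h0, h1, sub_zero]

lemma isInterior_or_isBoundary (i : Fin N) :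
    P.IsInterior Ω i ∨ P.IsBoundary Ω i := by
  have hi : P.center i ∈ closure Ω := by
    rw [← hT.space_eq]
    have : P.center i ∈ T.vertices := by rw [hT.vertices_eq]; exact ⟨i, rfl⟩
    exact T.subset_space this (by simp)
  rw [closure_eq_self_union_frontier] at hi
  exact hi

/-- Otherwise the vertex with the largest first coordinate would be interior, and `Ω` would extend
beyond the convex hull of the centers. -/
lemma exists_isBoundary (hΩ : IsOpen Ω) (hne : Ω.Nonempty) : ∃ i, P.IsBoundary Ω i := by
  by_contra! hcon
  have hsub : Ω ⊆ convexHull ℝ (Set.range P.center) := by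
    intro x hx
    have hs : x ∈ T.space := by rw [hT.space_eq]; exact subset_closure hx
    obtain ⟨s, hs, hxs⟩ := T.mem_space_iff.mp hs
    exact convexHull_mono (fun y hy => hT.mem_range_of_mem_face hs hy) hxs
  obtain ⟨x, hx⟩ := hne
  have hN : Nonempty (Fin N) := by
    by_contra hN
    rw [not_nonempty_iff] at hN
    have := hsub hx
    simp [Set.range_eq_empty] at this
  obtain ⟨i, hi⟩ := Finite.exists_max fun i => P.center i 0
  have hiΩ := (hT.isInterior_or_isBoundary i).resolve_right (hcon i)
  have hc : Continuous fun s : ℝ => P.center i + s • (!₂[1, 0] : Plane) := by fun_prop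
  have ht := hc.tendsto 0
  simp only [zero_smul, add_zero] at ht
  have h1 := (ht.mono_left (nhdsWithin_le_nhds (s := Set.Ioi 0))).eventually (hΩ.mem_nhds hiΩ)
  obtain ⟨s, hs, hs0⟩ := (h1.and self_mem_nhdsWithin).exists
  have hhalf : convexHull ℝ (Set.range P.center) ⊆ {y | y 0 ≤ P.center i 0} := by
    apply convexHull_min
    · rintro _ ⟨j, rfl⟩
      exact hi j
    · intro a ha b hb s t hs ht hst
      simp only [Set.mem_ofPred_eq, PiLp.add_apply, PiLp.smul_apply, smul_eq_mul] at *
      calc s * a 0 + t * b 0 ≤ s * P.center i 0 + t * P.center i 0 := by gcongr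
        _ = P.center i 0 := by rw [← add_mul, hst, one_mul]
  have h2 := hhalf (hsub hs)
  simp at h2
  exact absurd hs0 (not_lt.mpr h2)

end IsTriangulation

/-- Infinitesimal rigidity of the network with fixed boundary. -/
lemma eq_zero_of_elongation_eq_zero
    (hbuilt : BuiltFromTriangles P.contactGraph P.contactGraph.edgeSet)
    (hadj : ∀ i, ∃ j, P.contactGraph.Adj i j) {a b : Fin N} (hab : a ≠ b) {v : Fin N → Plane}
    (ha : v a = 0) (hb : v b = 0)
    (hv : ∀ i j, P.contactGraph.Adj i j → P.elongation v i j = 0) : v = 0 := by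
  obtain ⟨c, α, h⟩ := P.exists_rigid_of_built hv hbuilt
  have h' : ∀ i, v i = c + α • K (P.center i) := by
    intro i
    obtain ⟨j, hj⟩ := hadj i
    exact h s(i, j) hj i (by simp)
  have hα : α = 0 := by
    by_contra hα
    have h1 : α • K (P.center a) = α • K (P.center b) := by
      rw [h' a] at ha
      rw [h' b] at hb
      exact add_left_cancel (ha.trans hb.symm)
    have h2 := smul_right_injective Plane hα h1
    apply hab (P.center_injective (plane_ext ?_ ?_))
    · simpa using congrArg (fun x : Plane => x 1) h2
    · simpa using congrArg (fun x : Plane => x 0) h2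
  have hc : c = 0 := by simpa [h' a, hα] using ha
  funext i
  simp [h' i, hα, hc]

end DiskPacking

/-! ### The feasible polytope and its extreme points -/

namespace DiskPacking

variable {N M : ℕ} (P : DiskPacking N)

/-- The elongation of an edge as a linear function of the displacements. -/
def elongationMap (i j : Fin N) : (Fin N → Plane) →ₗ[ℝ] ℝ where
  toFun u := P.elongation u i j
  map_add' u v := by
    simp only [elongation, Pi.add_apply, add_sub_add_comm, inner_add_left]
  map_smul' s u := by
    simp only [elongation, Pi.smul_apply, ← smul_sub, inner_smul_left]
    simp

lemma elongation_add (u v : Fin N → Plane) (i j : Fin N) :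
    P.elongation (u + v) i j = P.elongation u i j + P.elongation v i j :=
  (P.elongationMap i j).map_add u v

lemma elongation_sub (u v : Fin N → Plane) (i j : Fin N) :
    P.elongation (u - v) i j = P.elongation u i j - P.elongation v i j :=
  (P.elongationMap i j).map_sub u v

lemma elongation_smul (s : ℝ) (u : Fin N → Plane) (i j : Fin N) :
    P.elongation (s • u) i j = s * P.elongation u i j :=
  (P.elongationMap i j).map_smul s u

lemma continuous_elongation (i j : Fin N) : Continuous fun u => P.elongation u i j :=
  (P.elongationMap i j).continuous_of_finiteDimensional

lemma isActive_symm {u : Fin N → Plane} {i j : Fin N} (h : P.IsActive u i j) :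
    P.IsActive u j i :=
  ⟨h.1.symm, by rw [elongation_symm]; exact h.2⟩

/-- If the elongations of the edges in `A` determine the displacements that vanish on the
boundary, then they control their norm. -/
lemma exists_norm_le_sum_elongation (Ω : Set Plane) (A : Finset (Fin N × Fin N))
    (hA : ∀ v : Fin N → Plane, (∀ i, P.IsBoundary Ω i → v i = 0) →
      (∀ e ∈ A, P.elongation v e.1 e.2 = 0) → v = 0) :
    ∃ C : ℝ, 0 ≤ C ∧ ∀ v : Fin N → Plane, (∀ i, P.IsBoundary Ω i → v i = 0) →
      ‖v‖ ≤ C * ∑ e ∈ A, |P.elongation v e.1 e.2| := by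
  -- An injective linear map on a finite-dimensional space is bounded below.
  let L : (Fin N → Plane) →ₗ[ℝ] (A → ℝ) × ({i // P.IsBoundary Ω i} → Plane) :=
    (LinearMap.pi fun e => P.elongationMap e.1.1 e.1.2).prod
      (LinearMap.pi fun i => LinearMap.proj i.1)
  have hL : LinearMap.ker L = ⊥ := by
    rw [LinearMap.ker_eq_bot']
    intro v hv
    have h1 := congrArg Prod.fst hv
    have h2 := congrArg Prod.snd hv
    exact hA v (fun i hi => congrFun h2 ⟨i, hi⟩) fun e he => congrFun h1 ⟨e, he⟩
  obtain ⟨C, -, hC⟩ := L.exists_antilipschitzWith hL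
  refine ⟨C, C.2, fun v hv => ?_⟩
  have h := hC.le_mul_dist v 0
  rw [map_zero, dist_zero_right, dist_zero_right] at h
  refine h.trans (mul_le_mul_of_nonneg_left ?_ C.2)
  have h0 : 0 ≤ ∑ e ∈ A, |P.elongation v e.1 e.2| := Finset.sum_nonneg fun _ _ => abs_nonneg _
  rw [Prod.norm_def]
  refine max_le ?_ ?_
  · rw [pi_norm_le_iff_of_nonneg h0]
    intro e
    have he : ‖(L v).1 e‖ = |P.elongation v e.1.1 e.1.2| := rfl
    rw [he]
    exact Finset.single_le_sum (f := fun e : Fin N × Fin N => |P.elongation v e.1 e.2|)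
      (fun _ _ => abs_nonneg _) e.2
  · rw [pi_norm_le_iff_of_nonneg h0]
    rintro ⟨i, hi⟩
    have : (L v).2 ⟨i, hi⟩ = v i := rfl
    rw [this, hv i hi, norm_zero]
    exact h0

lemma abs_elongation_le (v : Fin N → Plane) (i j : Fin N) : |P.elongation v i j| ≤ 2 * ‖v‖ := by
  have hq : ‖P.q i j‖ ≤ 1 := by
    unfold q
    rw [norm_smul, norm_inv, norm_norm]
    exact inv_mul_le_one
  calc |P.elongation v i j| ≤ ‖v j - v i‖ * ‖P.q i j‖ := abs_real_inner_le_norm _ _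
    _ ≤ ‖v j - v i‖ * 1 := by gcongr
    _ ≤ ‖v j‖ + ‖v i‖ := by rw [mul_one]; exact norm_sub_le _ _
    _ ≤ 2 * ‖v‖ := by linarith [norm_le_pi_norm v i, norm_le_pi_norm v j]

/-- The edges of the contact graph as a finite set of pairs. -/
def edgeFinset : Finset (Fin N × Fin N) :=
  Finset.univ.filter fun e => P.contactGraph.Adj e.1 e.2

lemma mem_edgeFinset {e : Fin N × Fin N} : e ∈ P.edgeFinset ↔ P.contactGraph.Adj e.1 e.2 := by
  simp [edgeFinset]

lemma energy_eq (d : ℝ) (δ : Fin N → Fin N → ℝ) (u : Fin N → Plane) : P.energy d δ u =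
    1 / 2 * (d ^ 3)⁻¹ * ∑ e ∈ P.edgeFinset, (P.elongation u e.1 e.2 - d * δ e.1 e.2) ^ 2 := by
  unfold energy edgeFinset
  rw [Finset.sum_filter, Fintype.sum_prod_type]
  simp_rw [Finset.sum_filter]

variable {P} {Ω : Set Plane} {B : BoundaryMotion N M}

lemma sub_eq_zero_of_feasible {u w : Fin N → Plane} (hu : u ∈ P.feasible Ω B)
    (hw : w ∈ P.feasible Ω B) (i : Fin N) (hi : P.IsBoundary Ω i) : (u - w) i = 0 := by
  rw [Pi.sub_apply, hu.2 i hi, hw.2 i hi, sub_self]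

lemma isClosed_feasible : IsClosed (P.feasible Ω B) := by
  have h : P.feasible Ω B =
      (⋂ (i) (j) (_ : P.contactGraph.Adj i j), {u | 0 ≤ P.elongation u i j}) ∩
      ⋂ (i) (_ : P.IsBoundary Ω i), {u | u i = B.rigid (B.group i) (P.center i)} := by
    ext u; simp [feasible]
  rw [h]
  refine IsClosed.inter ?_ ?_
  · exact isClosed_iInter fun i => isClosed_iInter fun j => isClosed_iInter fun _ =>
      isClosed_le continuous_const (P.continuous_elongation i j)
  · exact isClosed_iInter fun i => isClosed_iInter fun _ =>
      isClosed_eq (continuous_apply i) continuous_const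

/-- The feasible set is compact: positive stresses that are in equilibrium in the interior bound
the elongations, and these bound the displacements. -/
lemma isCompact_feasible {T : Geometry.SimplicialComplex ℝ Plane} (hT : P.IsTriangulation Ω T)
    (hΩ : IsOpen Ω)
    (hrigid : ∀ v : Fin N → Plane, (∀ i, P.IsBoundary Ω i → v i = 0) →
      (∀ e ∈ P.edgeFinset, P.elongation v e.1 e.2 = 0) → v = 0) :
    IsCompact (P.feasible Ω B) := by
  refine Metric.isCompact_of_isClosed_isBounded isClosed_feasible ?_
  rcases (P.feasible Ω B).eq_empty_or_nonempty with he | ⟨w, hw⟩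
  · rw [he]; exact Bornology.isBounded_empty
  obtain ⟨C, hC0, hC⟩ := P.exists_norm_le_sum_elongation Ω P.edgeFinset hrigid
  have hterm : ∀ u ∈ P.feasible Ω B, ∀ i j, 0 ≤ P.stress T i j * P.elongation u i j := by
    intro u hu i j
    by_cases h : P.contactGraph.Adj i j
    · exact mul_nonneg (hT.stress_pos h).le (hu.1 i j h)
    · simp [hT.stress_eq_zero h]
  set W := ∑ i, ∑ j, P.stress T i j * P.elongation w i j with hW
  have hbound : ∀ u ∈ P.feasible Ω B, ∀ e ∈ P.edgeFinset,
      P.elongation u e.1 e.2 ≤ W / P.stress T e.1 e.2 := by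
    intro u hu e he
    rw [mem_edgeFinset] at he
    rw [le_div_iff₀' (hT.stress_pos he)]
    -- Feasible displacements agree on the boundary, so their difference does no work: `W` does not
    -- depend on the choice of `w`.
    have hv := hT.sum_stress_mul_elongation hΩ (v := u - w) fun i hi =>
      sub_eq_zero_of_feasible hu hw i ((hT.isInterior_or_isBoundary i).resolve_left hi)
    simp_rw [elongation_sub, mul_sub, Finset.sum_sub_distrib] at hv
    rw [← hW, sub_eq_zero] at hv
    rw [← hv]
    calc P.stress T e.1 e.2 * P.elongation u e.1 e.2
        ≤ ∑ j, P.stress T e.1 j * P.elongation u e.1 j :=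
          Finset.single_le_sum (f := fun j => P.stress T e.1 j * P.elongation u e.1 j)
            (fun j _ => hterm u hu e.1 j) (Finset.mem_univ _)
      _ ≤ _ := Finset.single_le_sum
            (f := fun i => ∑ j, P.stress T i j * P.elongation u i j)
            (fun i _ => Finset.sum_nonneg fun j _ => hterm u hu i j) (Finset.mem_univ _)
  refine isBounded_iff_forall_norm_le.mpr
    ⟨‖w‖ + C * ∑ e ∈ P.edgeFinset, (W / P.stress T e.1 e.2 + P.elongation w e.1 e.2),
      fun u hu => ?_⟩
  have h1 : ‖u‖ ≤ ‖w‖ + ‖u - w‖ := by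
    calc ‖u‖ = ‖w + (u - w)‖ := by rw [add_sub_cancel]
      _ ≤ _ := norm_add_le _ _
  refine h1.trans (add_le_add_right ((hC _ (sub_eq_zero_of_feasible hu hw)).trans
    (mul_le_mul_of_nonneg_left (Finset.sum_le_sum fun e he => ?_) hC0)) _)
  have h2 := hbound u hu e he
  have h3 := hu.1 _ _ ((P.mem_edgeFinset).mp he)
  have h4 := hw.1 _ _ ((P.mem_edgeFinset).mp he)
  rw [elongation_sub, abs_le]
  constructor <;> linarith

/-- At an extreme point of the feasible set, the active edges determine the displacement. -/
lemma eq_zero_of_mem_extremePoints {u v : Fin N → Plane}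
    (hu : u ∈ (P.feasible Ω B).extremePoints ℝ) (hv : ∀ i, P.IsBoundary Ω i → v i = 0)
    (hact : ∀ i j, P.IsActive u i j → P.elongation v i j = 0) : v = 0 := by
  -- A small multiple of `v`, of either sign, leaves the active constraints unchanged and the strict
  -- ones strict, so `u` would be the midpoint of a feasible segment.
  have hev : ∀ᶠ s : ℝ in nhds 0, u + s • v ∈ P.feasible Ω B := by
    have h1 : ∀ i j, ∀ᶠ s : ℝ in nhds 0,
        P.contactGraph.Adj i j → 0 ≤ P.elongation (u + s • v) i j := by
      intro i j
      by_cases h : P.contactGraph.Adj i j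
      swap
      · exact Filter.Eventually.of_forall fun s h' => absurd h' h
      rcases (hu.1.1 i j h).eq_or_lt with h0 | h0
      · refine Filter.Eventually.of_forall fun s _ => ?_
        rw [elongation_add, elongation_smul, hact i j ⟨h, h0.symm⟩, ← h0]
        simp
      · have hc : Continuous fun s : ℝ => P.elongation (u + s • v) i j :=
          (P.continuous_elongation i j).comp (by fun_prop)
        have ht := hc.tendsto 0
        simp only [zero_smul, add_zero] at ht
        filter_upwards [ht.eventually (lt_mem_nhds h0)] with s hs _ using hs.le
    filter_upwards [Filter.eventually_all.mpr fun i => Filter.eventually_all.mpr (h1 i)] with s hs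
    refine ⟨hs, fun i hi => ?_⟩
    simp [hv i hi, hu.1.2 i hi]
  have hneg : ∀ᶠ s : ℝ in nhds 0, u + (-s) • v ∈ P.feasible Ω B := by
    have ht : Filter.Tendsto (fun s : ℝ => -s) (nhds 0) (nhds 0) := by
      simpa using (continuous_neg (G := ℝ)).tendsto 0
    exact ht.eventually hev
  obtain ⟨s, ⟨hs, hs'⟩, hs0⟩ := (((hev.and hneg).filter_mono
    (nhdsWithin_le_nhds (s := Set.Ioi 0))).and self_mem_nhdsWithin).exists
  have hmem : u ∈ openSegment ℝ (u + s • v) (u + (-s) • v) :=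
    ⟨1 / 2, 1 / 2, by norm_num, by norm_num, by norm_num, by module⟩
  have h := hu.2 hs hs' hmem
  have h2 : s • v = 0 := by simpa using h
  exact (smul_eq_zero.mp h2).resolve_left (ne_of_gt hs0)

/-- Every interior vertex has two active edges with independent directions if the active edges
determine the displacements that vanish on the boundary. -/
lemma exists_isActive_linearIndependent {u : Fin N → Plane}
    (hu : ∀ v : Fin N → Plane, (∀ i, P.IsBoundary Ω i → v i = 0) →
      (∀ i j, P.IsActive u i j → P.elongation v i j = 0) → v = 0)
    {i : Fin N} (hi : ¬P.IsBoundary Ω i) :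
    ∃ j k, P.IsActive u i j ∧ P.IsActive u i k ∧ LinearIndependent ℝ ![P.q i j, P.q i k] := by
  by_contra! hcon
  -- If the active directions at `i` span at most a line, moving `i` alone along `w` changes no
  -- active edge to first order.
  obtain ⟨w, hw0, hw⟩ : ∃ w : Plane, w ≠ 0 ∧ ∀ j, P.IsActive u i j → inner ℝ w (P.q i j) = 0 := by
    by_cases hex : ∃ j, P.IsActive u i j
    · obtain ⟨j, hj⟩ := hex
      have hq : P.q i j ≠ 0 := by
        have := P.norm_sub_pos_of_adj hj.1
        exact smul_ne_zero (inv_ne_zero this.ne') (norm_pos_iff.mp this)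
      refine ⟨K (P.q i j), ?_, fun k hk => ?_⟩
      · intro h
        apply hq
        apply plane_ext
        · simpa using congrArg (fun x : Plane => x 1) h
        · simpa using congrArg (fun x : Plane => x 0) h
      · by_contra hne
        refine hcon j k hj hk (linearIndependent_of_cross_ne_zero fun h => hne ?_)
        rw [inner_plane]
        unfold cross at h
        simp only [K_zero_coord, K_one_coord]
        linarith
    · push Not at hex
      refine ⟨!₂[1, 0], fun h => ?_, fun j hj => absurd hj (hex j)⟩
      simpa using congrArg (fun x : Plane => x 0) h
  let v : Fin N → Plane := Function.update 0 i w
  have hvi : v i = w := Function.update_self ..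
  have hv : ∀ j, j ≠ i → v j = 0 := fun j hj => Function.update_of_ne hj ..
  have h : v = 0 := by
    refine hu v (fun j hj => hv j (by rintro rfl; exact hi hj)) fun j k hjk => ?_
    have hne := hjk.1.ne
    by_cases hj : j = i
    · subst hj
      unfold elongation
      rw [hvi, hv k hne.symm, zero_sub, inner_neg_left, hw k hjk, neg_zero]
    · by_cases hk : k = i
      · subst hk
        rw [← elongation_symm]
        unfold elongation
        rw [hvi, hv j hj, zero_sub, inner_neg_left, hw j (P.isActive_symm hjk), neg_zero]
      · unfold elongation
        rw [hv j hj, hv k hk]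
        simp
  exact hw0 (by rw [← hvi, h, Pi.zero_apply])

/-- An extreme point of the feasible set that maximizes the total elongation is the unique
minimizer of the energy for suitable `δ` and all large `d`. -/
lemma exists_energy_lt {u : Fin N → Plane} (hu : u ∈ (P.feasible Ω B).extremePoints ℝ)
    (hmax : ∀ w ∈ P.feasible Ω B, ∑ e ∈ P.edgeFinset, P.elongation w e.1 e.2 ≤
      ∑ e ∈ P.edgeFinset, P.elongation u e.1 e.2) :
    ∃ dstar : ℝ, 0 < dstar ∧ ∀ d, dstar < d → ∀ w ∈ P.feasible Ω B, w ≠ u →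
      P.energy d (fun i j => if P.IsActive u i j then 5 / 8 else 3 / 4) u <
        P.energy d (fun i j => if P.IsActive u i j then 5 / 8 else 3 / 4) w := by
  set A := P.edgeFinset.filter fun e => P.IsActive u e.1 e.2 with hA
  obtain ⟨C, hC0, hC⟩ := P.exists_norm_le_sum_elongation Ω A fun v hv hvA =>
    eq_zero_of_mem_extremePoints hu hv fun i j hij =>
      hvA (i, j) (by rw [hA, Finset.mem_filter, mem_edgeFinset]; exact ⟨hij.1, hij⟩)
  set S := ∑ e ∈ P.edgeFinset, P.elongation u e.1 e.2 with hS
  have hpos : ∀ w ∈ P.feasible Ω B, ∀ e ∈ P.edgeFinset, 0 ≤ P.elongation w e.1 e.2 :=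
    fun w hw e he => hw.1 _ _ ((P.mem_edgeFinset).mp he)
  have hS0 : 0 ≤ S := Finset.sum_nonneg (hpos u hu.1)
  refine ⟨16 * S * C + 1, by positivity, fun d hd w hw hwu => ?_⟩
  have hd0 : 0 < d := lt_trans (by positivity) hd
  rw [energy_eq, energy_eq]
  refine mul_lt_mul_of_pos_left ?_ (by positivity)
  set τ := ∑ e ∈ A, P.elongation w e.1 e.2 with hτ
  have hnorm : ‖w - u‖ ≤ C * τ := by
    refine (hC _ (sub_eq_zero_of_feasible hw hu.1)).trans_eq ?_
    congr 1
    refine Finset.sum_congr rfl fun e he => ?_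
    rw [hA, Finset.mem_filter] at he
    rw [elongation_sub, he.2.2, sub_zero, abs_of_nonneg (hpos w hw e he.1)]
  have hn0 : 0 < ‖w - u‖ := norm_pos_iff.mpr (sub_ne_zero.mpr hwu)
  have hτ0 : 0 < τ := by
    by_contra! h
    nlinarith
  -- The coefficient `3 / 2` is twice `3 / 4`; on active edges twice `5 / 8` leaves a surplus of `1
  -- / 4`. The square of the elongation is dropped on active edges; on the others the difference of
  -- squares is bounded below by its linearization at `u`.
  have hsq : ∀ e ∈ P.edgeFinset,
      (P.elongation u e.1 e.2 - d * if P.IsActive u e.1 e.2 then 5 / 8 else 3 / 4) ^ 2 +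
        (3 / 2 * d * (P.elongation u e.1 e.2 - P.elongation w e.1 e.2) +
        (1 / 4 * d * (if P.IsActive u e.1 e.2 then P.elongation w e.1 e.2 else 0) -
          4 * ‖w - u‖ * P.elongation u e.1 e.2)) ≤
      (P.elongation w e.1 e.2 - d * if P.IsActive u e.1 e.2 then 5 / 8 else 3 / 4) ^ 2 := by
    intro e he
    have h1 := P.abs_elongation_le (w - u) e.1 e.2
    rw [elongation_sub, abs_le] at h1
    have h2 := hpos u hu.1 e he
    split_ifs with hact
    · have h3 := hact.2
      rw [h3]
      nlinarith [sq_nonneg (P.elongation w e.1 e.2)]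
    · have h3 := mul_nonneg h2 (by linarith [h1.1] :
        0 ≤ P.elongation w e.1 e.2 - P.elongation u e.1 e.2 + 2 * ‖w - u‖)
      nlinarith [sq_nonneg (P.elongation w e.1 e.2 - P.elongation u e.1 e.2)]
  have hsum := Finset.sum_le_sum hsq
  rw [Finset.sum_add_distrib, Finset.sum_add_distrib, Finset.sum_sub_distrib, ← Finset.mul_sum,
    ← Finset.mul_sum, ← Finset.mul_sum, Finset.sum_sub_distrib, ← Finset.sum_filter, ← hA, ← hτ,
    ← hS] at hsum
  have h1 := hmax w hw
  have h2 : 0 ≤ d * (S - ∑ e ∈ P.edgeFinset, P.elongation w e.1 e.2) :=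
    mul_nonneg hd0.le (sub_nonneg.mpr h1)
  have h3 : S * ‖w - u‖ ≤ S * (C * τ) := mul_le_mul_of_nonneg_left hnorm hS0
  have h4 : (16 * S * C + 1) * τ < d * τ := mul_lt_mul_of_pos_right hd hτ0
  linarith

/-- A compact nonempty feasible set has an extreme point of maximal total elongation. -/
lemma exists_extremePoint_isMax (hcomp : IsCompact (P.feasible Ω B))
    (hne : (P.feasible Ω B).Nonempty) :
    ∃ u ∈ (P.feasible Ω B).extremePoints ℝ, ∀ w ∈ P.feasible Ω B,
      ∑ e ∈ P.edgeFinset, P.elongation w e.1 e.2 ≤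
        ∑ e ∈ P.edgeFinset, P.elongation u e.1 e.2 := by
  let f : StrongDual ℝ (Fin N → Plane) :=
    LinearMap.toContinuousLinearMap (∑ e ∈ P.edgeFinset, P.elongationMap e.1 e.2)
  have hf : ∀ u, f u = ∑ e ∈ P.edgeFinset, P.elongation u e.1 e.2 := by
    intro u
    simp only [f, LinearMap.coe_toContinuousLinearMap', LinearMap.sum_apply]
    rfl
  -- The maximizers form an exposed face. It is compact, so it has an extreme point, which is also
  -- extreme in the whole set.
  have hexp : IsExposed ℝ (P.feasible Ω B)
      {u ∈ P.feasible Ω B | ∀ w ∈ P.feasible Ω B, f w ≤ f u} := fun _ => ⟨f, rfl⟩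
  obtain ⟨x, hx, hxmax⟩ := hcomp.exists_isMaxOn hne f.continuous.continuousOn
  obtain ⟨u, hu⟩ := (hexp.isCompact hcomp).extremePoints_nonempty ⟨x, hx, hxmax⟩
  refine ⟨u, hexp.isExtreme.extremePoints_subset_extremePoints hu, fun w hw => ?_⟩
  simpa only [hf] using hu.1.2 w hw

end DiskPacking

/-! ### Counting active edges -/

lemma ncard_prod_eq_sum {N : ℕ} (R : Fin N → Fin N → Prop) :
    {e : Fin N × Fin N | R e.1 e.2}.ncard = ∑ i, {j | R i j}.ncard := by
  simp_rw [Set.ncard_eq_toFinset_card', Set.toFinset_ofPred, Finset.card_filter]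
  rw [Fintype.sum_prod_type]

namespace DiskPacking

variable {N M : ℕ} {P : DiskPacking N} {Ω : Set Plane} {B : BoundaryMotion N M}

lemma edgeCount_eq_sum : P.edgeCount = ∑ i, P.coordination i :=
  ncard_prod_eq_sum fun i j => P.contactGraph.Adj i j

lemma div_edgeCount_eq_inv_meanCoordination :
    (N : ℝ) / P.edgeCount = P.meanCoordination⁻¹ := by
  rw [meanCoordination, inv_div, edgeCount_eq_sum, Nat.cast_sum]

/-- The `N`-th neighborhood of a vertex is the whole network. -/
lemma orderParameter_eq (hconn : P.contactGraph.Preconnected) (u : Fin N → Plane) (i : Fin N) :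
    P.orderParameter u i N = (∑ j, ({k | P.IsActive u j k}.ncard : ℝ)) / P.edgeCount := by
  have hnb : ∀ j, j ∈ P.neighborhood i N := by
    intro j
    obtain ⟨p, hp⟩ := (hconn i j).exists_isPath
    refine ⟨p, hp, ?_⟩
    have := hp.length_lt
    rw [Fintype.card_fin] at this
    exact this.le
  have hE : P.neighborhoodEdges i N = P.edges := by
    ext e; simp [neighborhoodEdges, hnb]
  have hA : {e ∈ P.edges | P.IsActive u e.1 e.2} = {e | P.IsActive u e.1 e.2} := by
    ext e
    exact ⟨fun h => h.2, fun h => ⟨h.1, h⟩⟩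
  rw [orderParameter, hE, hA, ncard_prod_eq_sum (P.IsActive u), Nat.cast_sum]
  rfl

/-- Contacts within a group of boundary particles are active. -/
lemma groupNeighbors_subset_isActive {u : Fin N → Plane} (hu : u ∈ P.feasible Ω B) {i : Fin N}
    (hi : P.IsBoundary Ω i) : P.groupNeighbors Ω B i ⊆ {j | P.IsActive u i j} := by
  rintro j ⟨hj, hg, hij⟩
  refine ⟨hij, ?_⟩
  -- Translation and pivot cancel within a group; the rotation that remains is orthogonal to the
  -- contact.
  have e : u j - u i = B.α (B.group i) • K (P.center j - P.center i) := by
    rw [hu.2 i hi, hu.2 j hj, hg]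
    unfold BoundaryMotion.rigid
    rw [add_sub_add_left_eq_sub, ← smul_sub, ← K_sub, sub_sub_sub_cancel_right]
  unfold elongation q
  rw [e, inner_smul_left, inner_smul_right, inner_K_self]
  simp

lemma two_le_ncard_isActive {u : Fin N → Plane} {i j k : Fin N} (hj : P.IsActive u i j)
    (hk : P.IsActive u i k) (h : LinearIndependent ℝ ![P.q i j, P.q i k]) :
    2 ≤ {j | P.IsActive u i j}.ncard := by
  have hjk : j ≠ k := by
    rintro rfl
    have := h.injective.ne (show (0 : Fin 2) ≠ 1 by decide)
    exact this rfl
  rw [← Set.ncard_pair hjk]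
  refine Set.ncard_le_ncard ?_ (Set.toFinite _)
  rintro x (rfl | rfl) <;> assumption

/-- The summands are the guaranteed numbers of active edges at the vertices. -/
lemma sum_ite_isBoundary :
    ∑ i, (if P.IsBoundary Ω i then (1 : ℝ) else 2) = 2 * N - P.boundaryCount Ω := by
  have h : ∀ i, (if P.IsBoundary Ω i then (1 : ℝ) else 2) =
      2 - if P.IsBoundary Ω i then 1 else 0 := by
    intro i; split_ifs <;> norm_num
  simp_rw [h, Finset.sum_sub_distrib, Finset.sum_boole]
  rw [boundaryCount, Set.ncard_eq_toFinset_card', Set.toFinset_ofPred]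
  simp [mul_comm]

lemma boundaryCount_le : P.boundaryCount Ω ≤ N := by
  have := Set.ncard_le_ncard (Set.subset_univ {i | P.IsBoundary Ω i}) (Set.toFinite _)
  rwa [Set.ncard_univ, Nat.card_fin] at this

end DiskPacking

end GranularNetwork

end

/-! ### The main theorem -/

theorem mainTheorem4 {N M : ℕ} (P : GranularNetwork.DiskPacking N)
    (Ω : Set GranularNetwork.Plane) (B : GranularNetwork.BoundaryMotion N M)
    (hΩ : P.Triangulates Ω)
    (hbuilt : GranularNetwork.BuiltFromTriangles P.contactGraph P.contactGraph.edgeSet)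
    (hgroup : ∀ i, P.IsBoundary Ω i → (P.groupNeighbors Ω B i).Nonempty)
    (hfeas : (P.feasible Ω B).Nonempty) :
    ∃ (dstar : ℝ) (δ : Fin N → Fin N → ℝ), 0 < dstar ∧
      (∀ i j, δ i j = δ j i) ∧ (∀ i j, δ i j ∈ Set.Ioo (1 / 2 : ℝ) 1) ∧
      ∀ d : ℝ, dstar < d →
        ∃ u : Fin N → GranularNetwork.Plane,
          P.IsMinimizer Ω B d δ u ∧ (∀ v, P.IsMinimizer Ω B d δ v → v = u) ∧
          -- two active edges with linearly independent directions at each interior vertex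
          (∀ i, P.IsInterior Ω i → ∃ j k, P.IsActive u i j ∧ P.IsActive u i k ∧
            LinearIndependent ℝ ![P.q i j, P.q i k]) ∧
          -- the lower bound on the order parameter
          (∀ i, (N : ℝ) / P.edgeCount ≤ P.orderParameter u i N) ∧
          (N : ℝ) / P.edgeCount = (P.meanCoordination)⁻¹ ∧
          -- its form before boundary vertices are estimated
          (∀ i, (2 * N - P.boundaryCount Ω : ℝ) / P.edgeCount ≤ P.orderParameter u i N) ∧
          -- its form when two active edges can be counted at every vertex
          ((∀ i, P.IsBoundary Ω i → 2 ≤ (P.groupNeighbors Ω B i).ncard) →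
            ∀ i, 2 * (N : ℝ) / P.edgeCount ≤ P.orderParameter u i N) := by
  open GranularNetwork GranularNetwork.DiskPacking in
  obtain ⟨T, hTv, hTa, hTt, hTs⟩ := hΩ.exists_complex
  have hT : P.IsTriangulation Ω T := ⟨hTv, hTa, hTt, hTs⟩
  have hrigid : ∀ v : Fin N → Plane, (∀ i, P.IsBoundary Ω i → v i = 0) →
      (∀ e ∈ P.edgeFinset, P.elongation v e.1 e.2 = 0) → v = 0 := by
    intro v hv hve
    obtain ⟨a, ha⟩ := hT.exists_isBoundary hΩ.isOpen hΩ.isConnected.nonempty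
    -- A second fixed vertex is needed to exclude rotations about `a`; a group neighbor supplies it.
    obtain ⟨b, hb, -, hab⟩ := hgroup a ha
    exact eq_zero_of_elongation_eq_zero hbuilt hT.exists_adj hab.ne (hv a ha) (hv b hb)
      fun i j hij => hve (i, j) (P.mem_edgeFinset.mpr hij)
  have hconn : P.contactGraph.Preconnected := by
    obtain ⟨r, hr⟩ := hbuilt.exists_reachable
    have hr' : ∀ i, P.contactGraph.Reachable r i := by
      intro i
      obtain ⟨j, hj⟩ := hT.exists_adj i
      exact hr s(i, j) hj i (by simp)
    exact fun i j => (hr' i).symm.trans (hr' j)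
  obtain ⟨u, hu, hmax⟩ :=
    exists_extremePoint_isMax (isCompact_feasible (B := B) hT hΩ.isOpen hrigid) hfeas
  obtain ⟨dstar, hdstar, hlt⟩ := exists_energy_lt hu hmax
  -- `u` was chosen without reference to `d`, so `δ` is the same for all `d`.
  refine ⟨dstar, fun i j => if P.IsActive u i j then 5 / 8 else 3 / 4, hdstar, ?_, ?_,
    fun d hd => ?_⟩
  · intro i j
    exact if_congr ⟨P.isActive_symm, P.isActive_symm⟩ rfl rfl
  · intro i j
    dsimp only
    split_ifs <;> constructor <;> norm_num
  have hmin : P.IsMinimizer Ω B d (fun i j => if P.IsActive u i j then 5 / 8 else 3 / 4) u := by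
    refine ⟨hu.1, fun w hw => ?_⟩
    by_cases hwu : w = u
    · simp [hwu]
    · exact (hlt d hd w hw hwu).le
  have hind : ∀ i, ¬P.IsBoundary Ω i → ∃ j k, P.IsActive u i j ∧ P.IsActive u i k ∧
      LinearIndependent ℝ ![P.q i j, P.q i k] := fun i hi =>
    exists_isActive_linearIndependent (fun v hv h => eq_zero_of_mem_extremePoints hu hv h) hi
  have hbd : (2 * N - P.boundaryCount Ω : ℝ) ≤ ∑ i, ({j | P.IsActive u i j}.ncard : ℝ) := by
    rw [← sum_ite_isBoundary]
    refine Finset.sum_le_sum fun i _ => ?_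
    split_ifs with hi
    · have h1 := (hgroup i hi).mono (groupNeighbors_subset_isActive hu.1 hi)
      exact_mod_cast (Set.ncard_pos (Set.toFinite _)).mpr h1
    · obtain ⟨j, k, hj, hk, h⟩ := hind i hi
      exact_mod_cast two_le_ncard_isActive hj hk h
  refine ⟨u, hmin, fun v hv => ?_, fun i hi => hind i fun hb => ?_, fun i => ?_,
    div_edgeCount_eq_inv_meanCoordination, fun i => ?_, fun htwo i => ?_⟩
  · by_contra hvu
    exact absurd (hv.2 hu.1) (not_le.mpr (hlt d hd v hv.1 hvu))
  · rw [IsBoundary, hΩ.isOpen.frontier_eq] at hb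
    exact hb.2 hi
  · rw [orderParameter_eq hconn]
    refine div_le_div_of_nonneg_right (le_trans ?_ hbd) (Nat.cast_nonneg _)
    have : (P.boundaryCount Ω : ℝ) ≤ N := by exact_mod_cast boundaryCount_le
    linarith
  · rw [orderParameter_eq hconn]
    exact div_le_div_of_nonneg_right hbd (Nat.cast_nonneg _)
  · rw [orderParameter_eq hconn]
    refine div_le_div_of_nonneg_right ?_ (Nat.cast_nonneg _)
    calc 2 * (N : ℝ) = ∑ i : Fin N, (2 : ℝ) := by simp [mul_comm]
      _ ≤ _ := Finset.sum_le_sum fun i _ => ?_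
    by_cases hi : P.IsBoundary Ω i
    · have h1 := Set.ncard_le_ncard (groupNeighbors_subset_isActive hu.1 hi) (Set.toFinite _)
      exact_mod_cast (htwo i hi).trans h1
    · obtain ⟨j, k, hj, hk, h⟩ := hind i hi
      exact_mod_cast two_le_ncard_isActive hj hk h
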